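/- All $C^*$-algebras are finite-dimensional and unital, and all $*$-homomorphisms are unital. A *state* on $\mathcal A$ is a positive linear functional $\omega$ with $\omega(1)=1$; CPU means completely positive and unital. A state or CPU map $\varphi$ is *faithful* if $\varphi(a^*a)=0$ implies $a=0$. Let $\mathbf{NCFinStat}$ be the category whose objects are pairs $(\mathcal A,\omega)$ with $\mathcal A$ a $C^*$-algebra and $\omega$ a state on $\mathcal A$, and in which a morphism $(\mathcal B,\xi)\to(\mathcal A,\omega)$ is a pair $(F,Q)$ of a $*$-homomorphism $F:\mathcal B\to\mathcal A$ and a CPU map $Q:\mathcal A\to\mathcal B$ with $\omega\circ F=\xi$ and $Q\circ F=\mathrm{id}_{\mathcal B}$. The composite of $(G,R):(\mathcal C,\zeta)\to(\mathcal B,\xi)$ and $(F,Q):(\mathcal B,\xi)\to(\mathcal A,\omega)$ is $(F\circ G,R\circ Q)$. Identify $\mathcal A$ with a direct sum of matrix algebras $\bigoplus_{x\in X}\mathcal M_{m_x}$ by a $*$-isomorphism, and write states as $\omega=\sum_x p_x\,\mathrm{tr}(\rho_x\,\cdot\,)$ and $\omega'=\sum_x p'_x\,\mathrm{tr}(\rho'_x\,\cdot\,)$.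 The (Umegaki) relative entropy is $$S(\omega\,\|\,\omega')=\mathrm{tr}\Big(\bigoplus_{x\in X}p_x\rho_x\big(\log(p_x\rho_x)-\log(p'_x\rho'_x)\big)\Big)\qquad(0\log 0:=0)$$ if $\omega'(a^*a)=0$ implies $\omega(a^*a)=0$ for all $a\in\mathcal A$, and $S(\omega\,\|\,\omega')=\infty$ otherwise. For a morphism $(F,Q):(\mathcal B,\xi)\to(\mathcal A,\omega)$ put $\mathrm{RE}(F,Q)=S(\omega\,\|\,\xi\circ Q)$. **(1)** Let $(\mathcal C,\zeta)\xrightarrow{(G,R)}(\mathcal B,\xi)\xrightarrow{(F,Q)}(\mathcal A,\omega)$ be a composable pair in $\mathbf{NCFinStat}$ with $\omega,\xi,\zeta,Q,R$ all faithful. Then, for any identifications of $\mathcal A$ and $\mathcal B$ with direct sums of matrix algebras, $$S(\omega\,\|\,\zeta\circ R\circ Q)=S(\xi\,\|\,\zeta\circ R)+S(\omega\,\|\,\xi\circ Q),$$ that is, $\mathrm{RE}(F\circ G,R\circ Q)=\mathrm{RE}(G,R)+\mathrm{RE}(F,Q)$, and all three terms are finite. **(2)** The usual chain rule for the quantum conditional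 entropy is a special case. Let $a,b,c\in\mathbb N$ and let $\rho_{ABC}$ be a density matrix on $\mathcal M_a\otimes\mathcal M_b\otimes\mathcal M_c$, with partial traces $\rho_{BC}$ and $\rho_C$ over the first factor and over the first two factors. Let $G:\mathcal M_c\to\mathcal M_b\otimes\mathcal M_c$ and $F:\mathcal M_b\otimes\mathcal M_c\to\mathcal M_a\otimes\mathcal M_b\otimes\mathcal M_c$ be the inclusions $N\mapsto 1\otimes N$, and let $R(M)=\mathrm{tr}_{\mathcal M_b}\big((\tfrac1b 1\otimes 1)M\big)$ and $Q(M)=\mathrm{tr}_{\mathcal M_a}\big((\tfrac1a 1\otimes 1\otimes 1)M\big)$. Then $$\big(\mathcal M_c,\mathrm{tr}(\rho_C\,\cdot\,)\big)\xrightarrow{(G,R)}\big(\mathcal M_b\otimes\mathcal M_c,\mathrm{tr}(\rho_{BC}\,\cdot\,)\big)\xrightarrow{(F,Q)}\big(\mathcal M_a\otimes\mathcal M_b\otimes\mathcal M_c,\mathrm{tr}(\rho_{ABC}\,\cdot\,)\big)$$ is a composable pair in $\mathbf{NCFinStat}$, $Q$ and $R$ are faithful, and the three states are faithful if $\rho_{ABC}$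 is positive definite. With $H(B|C):=\mathrm{tr}(\rho_{BC}\log\rho_{BC})-\mathrm{tr}(\rho_C\log\rho_C)$, $H(A|BC):=\mathrm{tr}(\rho_{ABC}\log\rho_{ABC})-\mathrm{tr}(\rho_{BC}\log\rho_{BC})$ and $H(AB|C):=\mathrm{tr}(\rho_{ABC}\log\rho_{ABC})-\mathrm{tr}(\rho_C\log\rho_C)$ one has $$\mathrm{RE}(F\circ G,R\circ Q)=H(AB|C)+\log a+\log b,\quad \mathrm{RE}(G,R)=H(B|C)+\log b,\quad \mathrm{RE}(F,Q)=H(A|BC)+\log a,$$ and $H(AB|C)=H(A|BC)+H(B|C)$. -/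

import Mathlib

open scoped ComplexOrder CStarAlgebra Kronecker

noncomputable section

namespace NCStat

universe u v w

/-! ### States and completely positive unital maps -/

/-- A state on a unital C⋆-algebra: a positive linear functional with `ω 1 = 1`. -/
structure State (A : Type u) [CStarAlgebra A] [PartialOrder A] [StarOrderedRing A] where
  functional : A →ₚ[ℂ] ℂ
  map_one : functional 1 = 1

namespace State

variable {A : Type u} [CStarAlgebra A] [PartialOrder A] [StarOrderedRing A]

instance : CoeFun (State A) (fun _ => A → ℂ) := ⟨fun ω => ω.functional⟩

/-- `ω` is faithful: `ω(a⋆a) = 0` only for `a = 0`. -/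
def Faithful (ω : State A) : Prop := ∀ a : A, ω (star a * a) = 0 → a = 0

/-- `ω ≼ ω'`: `ω'(a⋆a) = 0` implies `ω(a⋆a) = 0`. -/
def AbsCont (ω ω' : State A) : Prop := ∀ a : A, ω' (star a * a) = 0 → ω (star a * a) = 0

end State

/-- A completely positive unital map of unital C⋆-algebras. -/
structure CPU (A : Type u) (B : Type v) [CStarAlgebra A] [PartialOrder A] [StarOrderedRing A]
    [CStarAlgebra B] [PartialOrder B] [StarOrderedRing B] where
  toCP : CompletelyPositiveMap A B
  map_one : toCP 1 = 1

namespace CPU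

variable {A : Type u} {B : Type v} {C : Type w}
  [CStarAlgebra A] [PartialOrder A] [StarOrderedRing A]
  [CStarAlgebra B] [PartialOrder B] [StarOrderedRing B]
  [CStarAlgebra C] [PartialOrder C] [StarOrderedRing C]

instance : CoeFun (CPU A B) (fun _ => A → B) := ⟨fun Q => Q.toCP⟩

/-- `Q` is faithful: `Q(a⋆a) = 0` only for `a = 0`. -/
def Faithful (Q : CPU A B) : Prop := ∀ a : A, Q (star a * a) = 0 → a = 0

/-- The composite `R ∘ Q`. -/
def comp (R : CPU B C) (Q : CPU A B) : CPU A C where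
  toCP :=
    { toLinearMap := R.toCP.toLinearMap.comp Q.toCP.toLinearMap
      map_cstarMatrix_nonneg' := fun k M hM =>
        R.toCP.map_cstarMatrix_nonneg' k _ (Q.toCP.map_cstarMatrix_nonneg' k M hM) }
  map_one := by
    change R (Q 1) = 1
    rw [Q.map_one, R.map_one]

end CPU

/-- The pullback `ξ ∘ Q` of a state `ξ` on `B` along a CPU map `Q` from `A` to `B`. -/
def State.pullback {A : Type u} {B : Type v}
    [CStarAlgebra A] [PartialOrder A] [StarOrderedRing A]
    [CStarAlgebra B] [PartialOrder B] [StarOrderedRing B]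
    (ξ : State B) (Q : CPU A B) : State A where
  functional := ξ.functional.comp (PositiveLinearMap.ofClass Q.toCP)
  map_one := by
    change ξ (Q 1) = 1
    rw [Q.map_one, ξ.map_one]

/-! ### The category of non-commutative probability spaces and hypotheses -/

/-- A morphism `(B, ξ) ⟶ (A, ω)`: a unital ⋆-homomorphism `F : B → A` and a CPU map `Q` from
`A` to `B` with `ω ∘ F = ξ` and `Q ∘ F = id`. -/
structure Hypothesis {A : Type u} {B : Type v}
    [CStarAlgebra A] [PartialOrder A] [StarOrderedRing A]
    [CStarAlgebra B] [PartialOrder B] [StarOrderedRing B]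
    (ξ : State B) (ω : State A) where
  F : B →⋆ₐ[ℂ] A
  Q : CPU A B
  state_comp : ∀ b : B, ω (F b) = ξ b
  section_comp : ∀ b : B, Q (F b) = b

/-- The composite of `(G, R) : (C, ζ) ⟶ (B, ξ)` and `(F, Q) : (B, ξ) ⟶ (A, ω)`,
namely `(F ∘ G, R ∘ Q) : (C, ζ) ⟶ (A, ω)`. -/
def Hypothesis.comp {A : Type u} {B : Type v} {C : Type w}
    [CStarAlgebra A] [PartialOrder A] [StarOrderedRing A]
    [CStarAlgebra B] [PartialOrder B] [StarOrderedRing B]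
    [CStarAlgebra C] [PartialOrder C] [StarOrderedRing C]
    {ζ : State C} {ξ : State B} {ω : State A}
    (f : Hypothesis ξ ω) (g : Hypothesis ζ ξ) : Hypothesis ζ ω where
  F := f.F.comp g.F
  Q := g.Q.comp f.Q
  state_comp := fun c => by
    change ω (f.F (g.F c)) = ζ c
    rw [f.state_comp, g.state_comp]
  section_comp := fun c => by
    change g.Q (f.Q (f.F (g.F c))) = c
    rw [f.section_comp, g.section_comp]

/-! ### Relative entropy -/

/-- A choice of ⋆-isomorphism identifying `A` with a finite direct sum `⨁ x, M_{n x}` of full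
matrix algebras. Every finite-dimensional C⋆-algebra has one, and `relEntropy` below does not
depend on it. -/
structure Blocks (A : Type u) [CStarAlgebra A] where
  X : Type
  [fintypeX : Fintype X]
  [decX : DecidableEq X]
  n : X → Type
  [fintypeN : ∀ x, Fintype (n x)]
  [decN : ∀ x, DecidableEq (n x)]
  iso : A ≃⋆ₐ[ℂ] ((x : X) → Matrix (n x) (n x) ℂ)

attribute [instance] Blocks.fintypeX Blocks.decX Blocks.fintypeN Blocks.decN

section Entropy

variable {A : Type u} [CStarAlgebra A] [PartialOrder A] [StarOrderedRing A]

/-- The unnormalized density matrix `p x • ρ x` of the block `x` of a state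
`ω = ∑ x, p x * tr (ρ x * ·)`. Its entry `(i, j)` is the value of `ω` at the matrix unit
`(j, i)` of that block. See `State.apply_eq_sum_trace_density`. -/
def State.density (ω : State A) (d : Blocks A) (x : d.X) : Matrix (d.n x) (d.n x) ℂ :=
  Matrix.of fun i j => ω (d.iso.symm (Pi.single x (Matrix.single j i (1 : ℂ))))

theorem State.apply_eq_sum_trace_density (ω : State A) (d : Blocks A) (a : A) :
    ω a = ∑ x, (ω.density d x * d.iso a x).trace := by
  have key : ∀ M : (x : d.X) → Matrix (d.n x) (d.n x) ℂ,
      ω (d.iso.symm M) = ∑ x, (ω.density d x * M x).trace := by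
    intro M
    have hM : M = ∑ x, ∑ j, ∑ i,
        M x j i • (Pi.single x (Matrix.single j i (1 : ℂ)) :
          (x : d.X) → Matrix (d.n x) (d.n x) ℂ) := by
      conv_lhs => rw [← Finset.univ_sum_single M]
      refine Finset.sum_congr rfl fun x _ => ?_
      conv_lhs => rw [Matrix.matrix_eq_sum_single (M x)]
      rw [← LinearMap.single_apply (R := ℂ)]
      simp only [map_sum]
      refine Finset.sum_congr rfl fun j _ => Finset.sum_congr rfl fun i _ => ?_
      rw [← LinearMap.single_apply (R := ℂ), ← map_smul, Matrix.smul_single]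
      simp
    have hL : ω (d.iso.symm M) = ∑ x, ∑ j, ∑ i, M x j i * ω.density d x i j := by
      conv_lhs => rw [hM]
      simp only [map_sum, map_smul, smul_eq_mul]
      rfl
    rw [hL]
    refine Finset.sum_congr rfl fun x _ => ?_
    simp only [Matrix.trace, Matrix.diag_apply, Matrix.mul_apply]
    rw [Finset.sum_comm]
    exact Finset.sum_congr rfl fun i _ => Finset.sum_congr rfl fun j _ => mul_comm _ _
  have := key (d.iso a)
  rwa [StarAlgEquiv.symm_apply_apply] at this

open Classical in
/-- The relative entropy `S(ω ‖ ω')` of two states on `A = ⨁ x, M_{n x}`: it is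
`tr (⨁ x, p x ρ x (log (p x ρ x) - log (p' x ρ' x)))` if `ω ≼ ω'`, and `∞` otherwise.
The logarithm of a positive matrix is given by the functional calculus, with `log 0 = 0`.
The trace is a real number. -/
def relEntropy (d : Blocks A) (ω ω' : State A) : EReal :=
  if ω.AbsCont ω' then
    (((∑ x, (ω.density d x *
      (cfc Real.log (ω.density d x) - cfc Real.log (ω'.density d x))).trace).re : ℝ) : EReal)
  else ⊤

/-- `RE (F, Q) = S(ω ‖ ξ ∘ Q)` for a morphism `(F, Q) : (B, ξ) ⟶ (A, ω)`. -/
def RE {B : Type v} [CStarAlgebra B] [PartialOrder B] [StarOrderedRing B]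
    {ξ : State B} {ω : State A} (d : Blocks A) (f : Hypothesis ξ ω) : EReal :=
  relEntropy d ω (ξ.pullback f.Q)

end Entropy

/-! ### Tensor products of matrix algebras and conditional entropy -/

section Tensor

variable {a b c : Type} [Fintype a] [DecidableEq a] [Fintype b] [DecidableEq b]
  [Fintype c] [DecidableEq c]

/-- The one-block identification of a full matrix algebra with itself. -/
def matrixBlocks (a : Type) [Fintype a] [DecidableEq a] : Blocks (CStarMatrix a a ℂ) where
  X := Unit
  n := fun _ => a
  iso :=
    { toFun := fun M _ => CStarMatrix.ofMatrix.symm M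
      invFun := fun M => CStarMatrix.ofMatrix (M ())
      left_inv := fun _ => rfl
      right_inv := fun _ => rfl
      map_mul' := fun _ _ => rfl
      map_add' := fun _ _ => rfl
      map_star' := fun _ => rfl
      map_smul' := fun _ _ => rfl }

/-- The partial trace over the first tensor factor, `tr_a (A ⊗ B) = tr(A) B`. -/
def partialTrace (M : Matrix (a × b) (a × b) ℂ) : Matrix b b ℂ :=
  Matrix.of fun j j' => ∑ i, M (i, j) (i, j')

/-- `tr (ρ log ρ)`, with `0 log 0 = 0`. -/
def traceLog (ρ : Matrix a a ℂ) : ℝ := (ρ * cfc Real.log ρ).trace.re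

/-- The quantum conditional entropy `H(a|b) = tr (ρ_{ab} log ρ_{ab}) - tr (ρ_b log ρ_b)`
of a density matrix on `M_a ⊗ M_b`, with the sign convention of this formula. -/
def condEntropy (ρ : Matrix (a × b) (a × b) ℂ) : ℝ :=
  traceLog ρ - traceLog (partialTrace ρ)

/-- The maximally mixed density matrix `1 / d`. -/
def maxMixed (a : Type) [Fintype a] [DecidableEq a] : Matrix a a ℂ :=
  ((Fintype.card a : ℂ)⁻¹) • (1 : Matrix a a ℂ)

end Tensor

theorem partialTrace_kronecker {a b : Type} [Fintype a] (M : Matrix a a ℂ) (N : Matrix b b ℂ) :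
    partialTrace (M ⊗ₖ N) = M.trace • N := by
  ext j j'
  simp [partialTrace, Matrix.trace, Finset.sum_mul]

end NCStat

end

/-! Fix faithful traces on `A` and `B` and describe states by their densities. Since `Q ∘ F = id`,
the range of `F` lies in the multiplicative domain of `Q`, so `Q` is `B`-bilinear along `F`
(`Hypothesis.map_F_mul`, `Hypothesis.map_mul_F`). Let `K` be the density of `τB ∘ Q`. Bilinearity
and traciality make `K` commute with the range of `F`, and the density of `η ∘ Q` is `K * F D` when
`D` is the density of `η`. For faithful data everything is invertible, so its logarithm is `log K +
F (log D)`, with `log K` independent of `η` (`Hypothesis.exists_log_density_pullback`). In the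
difference of the relative entropies of `ω` to `ζ ∘ R ∘ Q` and to `ξ ∘ Q` both `log K` and the
density of `ω` cancel; what remains is `ω ∘ F = ξ` applied to a difference of logarithms on `B`,
which is the entropy of `ξ` relative to `ζ ∘ R`.

The tensor product case allows singular density matrices, so it is computed directly instead of
being deduced from the chain rule. The reference density is `r • φ σ`, where `φ` is the inclusion
and `σ` the reduced density matrix. The support of `ρ` lies under that of `φ σ`, so the entropy is
finite, and `- log r` produces the terms `log a` and `log b` (`relEntropy_matrix`). -/

theorem CStarAlgebra.exists_eq_star_mul_self {A : Type*} [CStarAlgebra A] [PartialOrder A]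
    [StarOrderedRing A] {a : A} (ha : 0 ≤ a) : ∃ b, a = star b * b :=
  CStarAlgebra.nonneg_iff_eq_star_mul_self.mp ha

/-- Factoring `M = star N * N` turns the quadratic form into the sum of squares of the entries of `N
c`. -/
theorem CStarMatrix.sum_star_mul_mul_nonneg {n A : Type*} [Fintype n] [DecidableEq n]
    [CStarAlgebra A] [PartialOrder A] [StarOrderedRing A] {M : CStarMatrix n n A} (hM : 0 ≤ M)
    (c : n → A) : 0 ≤ ∑ i, ∑ j, star (c i) * M i j * c j := by
  obtain ⟨N, rfl⟩ := CStarAlgebra.exists_eq_star_mul_self hM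
  have h : ∑ i, ∑ j, star (c i) * (star N * N) i j * c j =
      ∑ k, star (∑ i, N k i * c i) * ∑ j, N k j * c j := by
    simp only [CStarMatrix.mul_apply, CStarMatrix.star_apply, star_sum, star_mul,
      Finset.sum_mul, Finset.mul_sum, mul_assoc]
    rw [Finset.sum_comm_cycle]
    exact Finset.sum_congr rfl fun k _ => Finset.sum_comm
  rw [h]
  exact Finset.sum_nonneg fun k _ => star_mul_self_nonneg _

/-- Dividing by `t = n → ∞` and using that the positive cone is closed gives `0 ≤ h`; negative `t`
gives `0 ≤ -h`. -/
theorem eq_zero_of_forall_nonneg_add_smul {A : Type*} [CStarAlgebra A] [PartialOrder A]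
    [StarOrderedRing A] {d h : A} (H : ∀ t : ℝ, 0 ≤ d + t • h) : h = 0 := by
  have aux : ∀ h : A, (∀ t : ℝ, 0 ≤ d + t • h) → 0 ≤ h := by
    intro h H
    have hn : ∀ᶠ n : ℕ in Filter.atTop, 0 ≤ ((n : ℝ)⁻¹) • d + h := by
      filter_upwards [Filter.eventually_gt_atTop 0] with n hn
      have hn' : (0 : ℝ) < n := by exact_mod_cast hn
      have := smul_nonneg (inv_nonneg.mpr hn'.le) (H n)
      rwa [smul_add, smul_smul, inv_mul_cancel₀ hn'.ne', one_smul] at this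
    have hlim : Filter.Tendsto (fun n : ℕ => ((n : ℝ)⁻¹) • d + h) Filter.atTop (nhds h) := by
      simpa using ((tendsto_inv_atTop_nhds_zero_nat (𝕜 := ℝ)).smul_const d).add_const h
    exact ge_of_tendsto hlim hn
  refine le_antisymm ?_ (aux h H)
  simpa using aux (-h) fun t => by simpa using H (-t)

namespace NCStat

noncomputable section

universe u v w

variable {A : Type u} {B : Type v} {C : Type w}
  [CStarAlgebra A] [PartialOrder A] [StarOrderedRing A]
  [CStarAlgebra B] [PartialOrder B] [StarOrderedRing B]
  [CStarAlgebra C] [PartialOrder C] [StarOrderedRing C]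

/-! ### Schwarz inequality and multiplicative domains -/

namespace CPU

theorem map_add (Q : CPU A B) (a b : A) : Q (a + b) = Q a + Q b := _root_.map_add Q.toCP a b
theorem map_smul (Q : CPU A B) (c : ℂ) (a : A) : Q (c • a) = c • Q a := _root_.map_smul Q.toCP c a
theorem map_neg (Q : CPU A B) (a : A) : Q (-a) = -Q a := _root_.map_neg Q.toCP a
theorem map_nonneg (Q : CPU A B) {a : A} (ha : 0 ≤ a) : 0 ≤ Q a := _root_.map_nonneg Q.toCP ha

theorem map_star (Q : CPU A B) (a : A) : Q (star a) = star (Q a) :=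
  StarHomClass.map_star (PositiveLinearMap.ofClass Q.toCP : A →ₚ[ℂ] B) a

/-- The Kadison–Schwarz inequality. -/
theorem star_mul_self_le (Q : CPU A B) (a : A) : star (Q a) * Q a ≤ Q (star a * a) := by
  -- Here `star N * N` has rows `(1, a)` and `(star a, star a * a)`. The quadratic form of its image
  -- under `Q` at `(-Q a, 1)` is `Q (star a * a) - star (Q a) * Q a`.
  let N : CStarMatrix (Fin 2) (Fin 2) A := CStarMatrix.ofMatrix !![1, a; 0, 0]
  have h := CStarMatrix.sum_star_mul_mul_nonneg
    (Q.toCP.map_cstarMatrix_nonneg' 2 (star N * N) (star_mul_self_nonneg N)) ![-Q a, 1]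
  have e : ∀ x, Q.toCP.toLinearMap x = Q x := fun _ => rfl
  simpa [Fin.sum_univ_two, CStarMatrix.mul_apply, CStarMatrix.star_apply, N, e, Q.map_one,
    Q.map_star, CStarMatrix.map_apply] using h

/-- The sesquilinear form `Q (star x * y) - star (Q x) * Q y` is positive by the Schwarz inequality.
A null vector `z` of a positive form is orthogonal to everything. -/
theorem map_star_mul_of_eq (Q : CPU A B) {z : A} (hz : Q (star z * z) = star (Q z) * Q z) (a : A) :
    Q (star z * a) = star (Q z) * Q a := by
  have sum_eq : ∀ z : A, Q (star z * z) = star (Q z) * Q z →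
      (Q (star z * a) - star (Q z) * Q a) + (Q (star a * z) - star (Q a) * Q z) = 0 := by
    intro z hz
    -- At `t z + a` the quadratic term in `t` vanishes, so the form is affine in `t`; being
    -- nonnegative for all real `t`, its slope is zero.
    refine eq_zero_of_forall_nonneg_add_smul (d := Q (star a * a) - star (Q a) * Q a) fun t => ?_
    have h := sub_nonneg.mpr (Q.star_mul_self_le (((t : ℝ) : ℂ) • z + a))
    convert h using 1
    simp only [Q.map_add, Q.map_smul, star_add, star_smul, add_mul, mul_add, smul_mul_assoc,
      mul_smul_comm, hz, ← Complex.coe_smul, RCLike.star_def, Complex.conj_ofReal, smul_sub,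
      smul_add]
    abel
  have h1 := sum_eq z hz
  -- Replacing `z` by `i z` changes the relative sign of the two cross terms, so both vanish.
  have h2 := sum_eq (Complex.I • z) (by simp [Q.map_smul, hz])
  have h3 : Q (star a * z) - star (Q a) * Q z = Q (star z * a) - star (Q z) * Q a := by
    have h4 := congrArg (fun x => (-Complex.I) • x) h2
    simp only [Q.map_smul, star_smul, smul_mul_assoc, mul_smul_comm, RCLike.star_def,
      Complex.conj_I, smul_add, smul_sub, Q.map_neg, smul_neg, smul_smul, neg_mul,
      Complex.I_mul_I, neg_neg, one_smul, smul_zero, neg_smul] at h4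
    rw [← sub_eq_zero, ← h4]
    abel
  rw [h3, ← two_smul ℝ, smul_eq_zero] at h1
  exact sub_eq_zero.mp (h1.resolve_left two_ne_zero)

end CPU

namespace Hypothesis

variable {ξ : State B} {ω : State A}

theorem map_F_mul (f : Hypothesis ξ ω) (b : B) (a : A) : f.Q (f.F b * a) = b * f.Q a := by
  have h := f.Q.map_star_mul_of_eq (z := f.F (star b))
    (by rw [← map_star, ← map_mul, f.section_comp, f.section_comp]) a
  rwa [← map_star, f.section_comp, star_star] at h

theorem map_mul_F (f : Hypothesis ξ ω) (b : B) (a : A) : f.Q (a * f.F b) = f.Q a * b := by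
  have h := congrArg star (f.map_F_mul (star b) (star a))
  rwa [← CPU.map_star, star_mul, ← map_star, star_star, star_star, star_mul, star_star,
    ← CPU.map_star, star_star] at h

end Hypothesis

/-! ### Faithful traces and densities -/

/-- A positive functional `τ` is a faithful trace. -/
structure IsFaithfulTrace (τ : A →ₚ[ℂ] ℂ) : Prop where
  mul_comm : ∀ a b, τ (a * b) = τ (b * a)
  faithful : ∀ a, τ (star a * a) = 0 → a = 0

namespace IsFaithfulTrace

variable {τ : A →ₚ[ℂ] ℂ}

omit [StarOrderedRing A] in
theorem density_ext (hτ : IsFaithfulTrace τ) {D E : A} (h : ∀ a, τ (D * a) = τ (E * a)) :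
    D = E := by
  refine sub_eq_zero.mp (hτ.faithful _ ?_)
  rw [hτ.mul_comm, sub_mul, map_sub, h, sub_self]

omit [StarOrderedRing A] in
-- The pairing `τ (D * a)` is nondegenerate, and `A` and its dual have the same dimension.
theorem exists_density [FiniteDimensional ℂ A] (hτ : IsFaithfulTrace τ) (φ : A →ₗ[ℂ] ℂ) :
    ∃ D, ∀ a, φ a = τ (D * a) := by
  let L : A →ₗ[ℂ] (A →ₗ[ℂ] ℂ) := (LinearMap.mul ℂ A).compr₂ τ.toLinearMap
  have hL : Function.Injective L := fun D E h =>
    hτ.density_ext fun a => by simpa using! DFunLike.congr_fun h a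
  obtain ⟨D, hD⟩ := (LinearMap.injective_iff_surjective_of_finrank_eq_finrank
    (Subspace.dual_finrank_eq (K := ℂ) (V := A)).symm).mp hL φ
  exact ⟨D, fun a => by rw [← hD]; rfl⟩

theorem density_isStrictlyPositive [FiniteDimensional ℂ A] (hτ : IsFaithfulTrace τ)
    {φ : A →ₚ[ℂ] ℂ} (hφ : ∀ a, φ (star a * a) = 0 → a = 0) {D : A}
    (hD : ∀ a, φ a = τ (D * a)) : IsStrictlyPositive D := by
  have hsa : IsSelfAdjoint D := hτ.density_ext fun a => by
    rw [← hD, hτ.mul_comm]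
    calc τ (a * star D) = τ (star (D * star a)) := by simp
      _ = star (φ (star a)) := by rw [map_star, hD]
      _ = φ a := by rw [map_star, star_star]
  -- Testing `φ` on `D⁻` gives `-τ (D⁻ * D⁻)`, which is at once nonnegative and nonpositive.
  have hneg : D⁻ = 0 := by
    have hnn : 0 ≤ D⁻ := CFC.negPart_nonneg D
    have h1 : φ (D⁻) = -τ (D⁻ * D⁻) := by
      have h : D * D⁻ = (D⁺ - D⁻) * D⁻ := by rw [CFC.posPart_sub_negPart D hsa]
      rw [hD, h, sub_mul, CFC.posPart_mul_negPart, zero_sub, map_neg]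
    have h2 : star (D⁻) * D⁻ = D⁻ * D⁻ := by rw [hnn.isSelfAdjoint.star_eq]
    have h3 : 0 ≤ τ (star (D⁻) * D⁻) := map_nonneg τ (star_mul_self_nonneg _)
    have h4 : 0 ≤ φ (D⁻) := map_nonneg φ hnn
    rw [h1, ← h2] at h4
    exact hτ.faithful _ (le_antisymm (neg_nonneg.mp h4) h3)
  have hnonneg : 0 ≤ D := by
    rw [← CFC.posPart_sub_negPart D hsa, hneg, sub_zero]
    exact CFC.posPart_nonneg D
  refine IsStrictlyPositive.iff_of_unital.mpr ⟨hnonneg, ?_⟩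
  -- If `D * a = 0` then `φ (a * star a) = 0`, so faithfulness kills `a`; in finite dimension
  -- injectivity yields a right inverse.
  have hinj : Function.Injective (LinearMap.mulLeft ℂ D) := by
    rw [← LinearMap.ker_eq_bot, LinearMap.ker_eq_bot']
    intro a ha
    have h0 : star a = 0 := hφ _ (by
      rw [hD, star_star, ← mul_assoc, show D * a = 0 from ha, zero_mul, map_zero])
    simpa using h0
  obtain ⟨E, hE⟩ := LinearMap.injective_iff_surjective.mp hinj 1
  have hE : D * E = 1 := hE
  have hE' : star E * D = 1 := by
    have := congrArg star hE
    rwa [star_mul, hsa.star_eq, star_one] at this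
  exact isUnit_iff_exists.mpr ⟨E, hE, (left_inv_eq_right_inv hE' hE) ▸ hE'⟩

end IsFaithfulTrace

theorem log_mul_of_commute {a b : A} (ha : IsStrictlyPositive a) (hb : IsStrictlyPositive b)
    (hab : Commute a b) : CFC.log (a * b) = CFC.log a + CFC.log b := by
  have hc : Commute (CFC.log a) (CFC.log b) := (hab.cfc_real Real.log).symm.cfc_real Real.log |>.symm
  let : NormedAlgebra ℚ A := .restrictScalars ℚ ℂ A
  have hexp : NormedSpace.exp (CFC.log a + CFC.log b) = a * b := by
    rw [NormedSpace.exp_add_of_commute hc, CFC.exp_log a, CFC.exp_log b]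
  rw [← hexp, CFC.log_exp _ (IsSelfAdjoint.log.add IsSelfAdjoint.log)]

omit [PartialOrder A] [StarOrderedRing A] in
theorem map_log (F : B →⋆ₐ[ℂ] A) {b : B} (hb : IsStrictlyPositive b) :
    F (CFC.log b) = CFC.log (F b) := by
  refine StarAlgHom.map_cfc F Real.log b ?_ (map_continuous F) hb.isSelfAdjoint
    (hb.isSelfAdjoint.map F)
  exact ContinuousOn.mono Real.continuousOn_log fun x hx => (hb.spectrum_pos hx).ne'

/-- For a morphism `(F, Q)` with `Q` faithful, the logarithm of the density of a pullback `η ∘ Q`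
of a faithful state `η` differs from the image under `F` of the logarithm of the density of `η`
by an element that depends on `Q` only. -/
theorem Hypothesis.exists_log_density_pullback [FiniteDimensional ℂ A] [FiniteDimensional ℂ B]
    {τA : A →ₚ[ℂ] ℂ} (hA : IsFaithfulTrace τA) {τB : B →ₚ[ℂ] ℂ} (hB : IsFaithfulTrace τB)
    {ξ : State B} {ω : State A} (f : Hypothesis ξ ω) (hQ : f.Q.Faithful) :
    ∃ K : A, ∀ (η : State B) (D : B) (E : A), η.Faithful → (∀ b, η b = τB (D * b)) →
      (∀ a, η.pullback f.Q a = τA (E * a)) → CFC.log E = CFC.log K + f.F (CFC.log D) := by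
  let φ : A →ₚ[ℂ] ℂ := τB.comp (PositiveLinearMap.ofClass f.Q.toCP)
  obtain ⟨K, hK⟩ := hA.exists_density φ.toLinearMap
  replace hK : ∀ a, τB (f.Q a) = τA (K * a) := hK
  have hKpos : IsStrictlyPositive K := by
    refine hA.density_isStrictlyPositive (φ := φ) (fun a ha => hQ a ?_) hK
    obtain ⟨c, hc⟩ := CStarAlgebra.exists_eq_star_mul_self
      (f.Q.map_nonneg (star_mul_self_nonneg a))
    have ha : τB (f.Q (star a * a)) = 0 := ha
    rw [hc] at ha ⊢
    rw [hB.faithful c ha, mul_zero]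
  -- Traciality of `τB` exchanges `b * Q a` with `Q a * b`, and bilinearity of `Q` carries this over
  -- to `A`.
  have hcomm : ∀ b, Commute K (f.F b) := fun b => hA.density_ext fun a => by
    calc τA (K * f.F b * a) = τB (f.Q (f.F b * a)) := by rw [hK, mul_assoc]
      _ = τB (f.Q (a * f.F b)) := by rw [f.map_F_mul, f.map_mul_F, hB.mul_comm]
      _ = τA (f.F b * K * a) := by rw [hK, ← mul_assoc, hA.mul_comm, mul_assoc]
  refine ⟨K, fun η D E hη hD hE => ?_⟩
  have hDpos : IsStrictlyPositive D := hB.density_isStrictlyPositive hη hD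
  have hFD : IsStrictlyPositive (f.F D) :=
    IsStrictlyPositive.iff_of_unital.mpr ⟨map_nonneg f.F hDpos.nonneg, hDpos.isUnit.map f.F⟩
  have hEK : E = K * f.F D := hA.density_ext fun a => by
    rw [← hE, mul_assoc, ← hK, f.map_F_mul, ← hD]
    rfl
  rw [hEK, log_mul_of_commute hKpos hFD (hcomm D), map_log f.F hDpos]

theorem State.Faithful.pullback {ξ : State B} {Q : CPU A B} (hξ : ξ.Faithful) (hQ : Q.Faithful) :
    (ξ.pullback Q).Faithful := by
  intro a ha
  refine hQ a ?_
  obtain ⟨c, hc⟩ := CStarAlgebra.exists_eq_star_mul_self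
    (Q.map_nonneg (star_mul_self_nonneg a))
  have ha : ξ (Q (star a * a)) = 0 := ha
  rw [hc] at ha ⊢
  rw [hξ c ha, mul_zero]

/-! ### From block logarithms to a single logarithm in the algebra -/

namespace Blocks

/-- The sum of the traces of the blocks. -/
def trace (d : Blocks A) : A →ₚ[ℂ] ℂ :=
  PositiveLinearMap.mk₀
    { toFun := fun a => ∑ x, (d.iso a x).trace
      map_add' := fun a b => by
        simp only [map_add, Pi.add_apply, Matrix.trace_add, Finset.sum_add_distrib]
      map_smul' := fun c a => by
        simp only [map_smul, Pi.smul_apply, Matrix.trace_smul, Finset.smul_sum, RingHom.id_apply] }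
    (by
      intro a ha
      obtain ⟨c, rfl⟩ := CStarAlgebra.exists_eq_star_mul_self ha
      refine Finset.sum_nonneg fun x _ => ?_
      rw [map_mul, map_star]
      exact (Matrix.posSemidef_conjTranspose_mul_self _).trace_nonneg)

theorem trace_apply (d : Blocks A) (a : A) : d.trace a = ∑ x, (d.iso a x).trace := rfl

theorem isFaithfulTrace (d : Blocks A) : IsFaithfulTrace d.trace where
  mul_comm a b := by
    simp only [trace_apply, map_mul, Pi.mul_apply]
    exact Finset.sum_congr rfl fun x _ => Matrix.trace_mul_comm _ _
  faithful a ha := by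
    rw [trace_apply, Finset.sum_eq_zero_iff_of_nonneg] at ha
    · apply d.iso.injective
      rw [map_zero]
      funext x
      have := ha x (Finset.mem_univ x)
      rw [map_mul, map_star] at this
      exact Matrix.trace_conjTranspose_mul_self_eq_zero_iff.mp this
    · intro x _
      rw [map_mul, map_star]
      exact (Matrix.posSemidef_conjTranspose_mul_self _).trace_nonneg

end Blocks

/-- The density of a state with respect to the sum of the traces of the blocks. -/
def State.totalDensity (ω : State A) (d : Blocks A) : A := d.iso.symm (ω.density d)

theorem State.apply_eq_trace_totalDensity (ω : State A) (d : Blocks A) (a : A) :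
    ω a = d.trace (ω.totalDensity d * a) := by
  rw [ω.apply_eq_sum_trace_density d, d.trace_apply, totalDensity]
  simp

/-- Projection to a block is a ⋆-homomorphism, hence commutes with the functional calculus;
faithfulness keeps the spectrum away from the singularity of `log`. -/
theorem State.cfc_log_density [FiniteDimensional ℂ A] {ω : State A} (d : Blocks A)
    (hω : ω.Faithful) (x : d.X) :
    cfc Real.log (ω.density d x) = d.iso (CFC.log (ω.totalDensity d)) x := by
  have hpos : IsStrictlyPositive (ω.totalDensity d) :=
    d.isFaithfulTrace.density_isStrictlyPositive hω (ω.apply_eq_trace_totalDensity d)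
  let π : A →⋆ₐ[ℂ] Matrix (d.n x) (d.n x) ℂ :=
    (Pi.evalStarAlgHom ℂ (fun x => Matrix (d.n x) (d.n x) ℂ) x).comp (d.iso : A →⋆ₐ[ℂ] _)
  have hπ : π (ω.totalDensity d) = ω.density d x := by
    change d.iso (d.iso.symm (ω.density d)) x = _
    rw [d.iso.apply_symm_apply]
  rw [← hπ]
  refine (StarAlgHom.map_cfc π Real.log _ ?_
    (LinearMap.continuous_of_finiteDimensional π.toAlgHom.toLinearMap) hpos.isSelfAdjoint
    (hpos.isSelfAdjoint.map π)).symm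
  exact ContinuousOn.mono Real.continuousOn_log fun x hx => (hpos.spectrum_pos hx).ne'

theorem relEntropy_of_faithful [FiniteDimensional ℂ A] (d : Blocks A) {ω ω' : State A}
    (hω : ω.Faithful) (hω' : ω'.Faithful) :
    relEntropy d ω ω' =
      (((ω (CFC.log (ω.totalDensity d) - CFC.log (ω'.totalDensity d))).re : ℝ) : EReal) := by
  have hac : ω.AbsCont ω' := fun a ha => by rw [hω' a ha, mul_zero, map_zero]
  rw [relEntropy, if_pos hac, ω.apply_eq_sum_trace_density d]
  simp only [State.cfc_log_density d hω, State.cfc_log_density d hω', map_sub, Pi.sub_apply]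

/-- The chain rule for the relative entropy. -/
theorem relEntropy_pullback_comp [FiniteDimensional ℂ A] [FiniteDimensional ℂ B]
    (dA : Blocks A) (dB : Blocks B) {ω : State A} {ξ : State B} {ζ : State C}
    (f : Hypothesis ξ ω) (R : CPU B C) (hω : ω.Faithful) (hξ : ξ.Faithful) (hζ : ζ.Faithful)
    (hQ : f.Q.Faithful) (hR : R.Faithful) :
    relEntropy dA ω (ζ.pullback (R.comp f.Q)) =
      relEntropy dB ξ (ζ.pullback R) + relEntropy dA ω (ξ.pullback f.Q) := by
  obtain ⟨K, hK⟩ := f.exists_log_density_pullback dA.isFaithfulTrace dB.isFaithfulTrace hQ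
  have hη := hζ.pullback hR
  have e : ζ.pullback (R.comp f.Q) = (ζ.pullback R).pullback f.Q := rfl
  rw [e, relEntropy_of_faithful dA hω (hη.pullback hQ), relEntropy_of_faithful dB hξ hη,
    relEntropy_of_faithful dA hω (hξ.pullback hQ), ← EReal.coe_add, EReal.coe_eq_coe_iff,
    hK ξ _ _ hξ (ξ.apply_eq_trace_totalDensity dB)
      ((ξ.pullback f.Q).apply_eq_trace_totalDensity dA),
    hK (ζ.pullback R) _ _ hη ((ζ.pullback R).apply_eq_trace_totalDensity dB)
      (((ζ.pullback R).pullback f.Q).apply_eq_trace_totalDensity dA), ← f.state_comp]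
  -- All terms are now values of `ω`, and the two copies of `ω (log K)` cancel.
  simp only [map_sub, map_add, Complex.sub_re, Complex.add_re]
  ring

end

end NCStat

theorem CStarMatrix.sum_apply {ι m n A : Type*} [AddCommMonoid A] (s : Finset ι)
    (M : ι → CStarMatrix m n A) (i : m) (j : n) : (∑ x ∈ s, M x) i j = ∑ x ∈ s, M x i j :=
  Matrix.sum_apply i j s M

namespace NCStat

noncomputable section

set_option linter.unusedSectionVars false

/-! ### Matrix preliminaries -/

section Matrix

variable {a b n m : Type} [Fintype a] [DecidableEq a] [Fintype b] [DecidableEq b]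
  [Fintype n] [DecidableEq n] [Fintype m] [DecidableEq m]

theorem trace_mul_star_mul_self_nonneg {ρ : Matrix n n ℂ} (hρ : ρ.PosSemidef)
    (M : Matrix n n ℂ) : 0 ≤ (ρ * (star M * M)).trace := by
  rw [← mul_assoc, Matrix.trace_mul_comm, ← mul_assoc]
  exact (hρ.mul_mul_conjTranspose_same M).trace_nonneg

open scoped MatrixOrder in
theorem exists_eq_conjTranspose_mul_self {ρ : Matrix n n ℂ} (hρ : ρ.PosSemidef) :
    ∃ X : Matrix n n ℂ, ρ = X.conjTranspose * X :=
  CStarAlgebra.nonneg_iff_eq_star_mul_self.mp hρ.nonneg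

/-- With `ρ = X⋆ X` the trace is the squared Hilbert–Schmidt norm of `X M⋆`, so `M X⋆ = 0`. -/
theorem mul_eq_zero_of_trace_mul_star_mul_self_eq_zero {ρ : Matrix n n ℂ} (hρ : ρ.PosSemidef)
    {M : Matrix n n ℂ} (h : (ρ * (star M * M)).trace = 0) : M * ρ = 0 := by
  obtain ⟨X, rfl⟩ := exists_eq_conjTranspose_mul_self hρ
  have h' : ((X * M.conjTranspose).conjTranspose * (X * M.conjTranspose)).trace = 0 := by
    rw [← h, Matrix.star_eq_conjTranspose, Matrix.conjTranspose_mul,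
      Matrix.conjTranspose_conjTranspose, mul_assoc M, Matrix.trace_mul_comm M]
    simp only [mul_assoc]
  have h0 := Matrix.trace_conjTranspose_mul_self_eq_zero_iff.mp h'
  have h1 := congrArg Matrix.conjTranspose h0
  rw [Matrix.conjTranspose_mul, Matrix.conjTranspose_conjTranspose,
    Matrix.conjTranspose_zero] at h1
  rw [← mul_assoc, h1, zero_mul]

theorem trace_partialTrace (M : Matrix (a × b) (a × b) ℂ) :
    (partialTrace M).trace = M.trace := by
  simp only [partialTrace, Matrix.trace, Matrix.diag_apply, Matrix.of_apply,
    Fintype.sum_prod_type]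
  exact Finset.sum_comm

theorem partialTrace_posSemidef {ρ : Matrix (a × b) (a × b) ℂ} (hρ : ρ.PosSemidef) :
    (partialTrace ρ).PosSemidef := by
  have h : partialTrace ρ = ∑ i, ρ.submatrix (fun j => (i, j)) (fun j => (i, j)) := by
    ext j j'
    simp [partialTrace, Matrix.sum_apply]
  rw [h]
  exact Matrix.posSemidef_sum _ fun i _ => hρ.submatrix _

theorem partialTrace_posDef [Nonempty a] {ρ : Matrix (a × b) (a × b) ℂ} (hρ : ρ.PosDef) :
    (partialTrace ρ).PosDef := by
  have h : partialTrace ρ = ∑ i, ρ.submatrix (fun j => (i, j)) (fun j => (i, j)) := by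
    ext j j'
    simp [partialTrace, Matrix.sum_apply]
  rw [h]
  exact Matrix.posDef_sum Finset.univ_nonempty fun i _ =>
    hρ.submatrix (Prod.mk_right_injective i)

/-- The partial trace is dual to the inclusion `X ↦ 1 ⊗ X`; this is the state-preservation
condition. -/
theorem trace_mul_one_kronecker (ρ : Matrix (a × b) (a × b) ℂ) (X : Matrix b b ℂ) :
    (ρ * ((1 : Matrix a a ℂ) ⊗ₖ X)).trace = (partialTrace ρ * X).trace := by
  simp only [partialTrace, Matrix.trace, Matrix.diag_apply, Matrix.mul_apply, Matrix.of_apply,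
    Fintype.sum_prod_type, Matrix.kroneckerMap_apply, Matrix.one_apply, ite_mul, one_mul,
    zero_mul, mul_ite, mul_zero, Finset.sum_mul]
  rw [Finset.sum_comm]
  refine Finset.sum_congr rfl fun j _ => ?_
  rw [Finset.sum_comm, Finset.sum_comm (s := (Finset.univ : Finset b))]
  refine Finset.sum_congr rfl fun i _ => ?_
  rw [Finset.sum_comm]
  simp

theorem partialTrace_maxMixed_mul (M : Matrix (a × b) (a × b) ℂ) :
    partialTrace ((maxMixed a ⊗ₖ (1 : Matrix b b ℂ)) * M) =
      (Fintype.card a : ℂ)⁻¹ • partialTrace M := by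
  have h : maxMixed a ⊗ₖ (1 : Matrix b b ℂ) =
      (Fintype.card a : ℂ)⁻¹ • (1 : Matrix (a × b) (a × b) ℂ) := by
    rw [maxMixed, Matrix.smul_kronecker, Matrix.one_kronecker_one]
  rw [h, smul_mul_assoc, one_mul]
  ext j j'
  simp [partialTrace, Finset.mul_sum]

theorem partialTrace_one_kronecker (X : Matrix b b ℂ) :
    partialTrace ((1 : Matrix a a ℂ) ⊗ₖ X) = (Fintype.card a : ℂ) • X := by
  rw [partialTrace_kronecker, Matrix.trace_one]

/-- The inclusion `X ↦ 1 ⊗ X` of `M_b` into `M_a ⊗ M_b`. -/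
def oneKronecker (a b : Type) [Fintype a] [DecidableEq a] [Fintype b] [DecidableEq b] :
    Matrix b b ℂ →⋆ₐ[ℂ] Matrix (a × b) (a × b) ℂ where
  toFun X := (1 : Matrix a a ℂ) ⊗ₖ X
  map_one' := Matrix.one_kronecker_one
  map_mul' X Y := by rw [← Matrix.mul_kronecker_mul, one_mul]
  map_zero' := Matrix.kronecker_zero _
  map_add' X Y := Matrix.kronecker_add _ _ _
  commutes' r := by
    simp only [Algebra.algebraMap_eq_smul_one, Matrix.kronecker_smul, Matrix.one_kronecker_one]
  map_star' X := by
    simp only [Matrix.star_eq_conjTranspose, Matrix.conjTranspose_kronecker,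
      Matrix.conjTranspose_one]

/-- The spectrum is finite, so even `log` and the inverse may be applied to singular matrices. -/
theorem continuousOn_spectrum (σ : Matrix n n ℂ) (f : ℝ → ℝ) :
    ContinuousOn f (spectrum ℝ σ) :=
  (Matrix.finite_real_spectrum (A := σ)).continuousOn f

theorem map_cfc_matrix (φ : Matrix m m ℂ →⋆ₐ[ℂ] Matrix n n ℂ) (f : ℝ → ℝ) {σ : Matrix m m ℂ}
    (hσ : IsSelfAdjoint σ) : φ (cfc f σ) = cfc f (φ σ) :=
  StarAlgHom.map_cfc φ f σ (continuousOn_spectrum σ f)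
    (LinearMap.continuous_of_finiteDimensional φ.toAlgHom.toLinearMap) hσ (hσ.map φ)

/-- The support projection of a Hermitian matrix. -/
def support (σ : Matrix n n ℂ) : Matrix n n ℂ := cfc (fun x : ℝ => x * x⁻¹) σ

theorem mul_support {σ : Matrix n n ℂ} (hσ : IsSelfAdjoint σ) : σ * support σ = σ := by
  have h := cfc_mul (R := ℝ) id (fun x : ℝ => x * x⁻¹) σ (continuousOn_spectrum σ _)
    (continuousOn_spectrum σ _)
  rw [cfc_id ℝ σ] at h
  rw [support, ← h]
  conv_rhs => rw [← cfc_id ℝ σ]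
  exact cfc_congr fun x _ => by simp [← mul_assoc]

theorem mul_cfc_inv {σ : Matrix n n ℂ} (hσ : IsSelfAdjoint σ) :
    σ * cfc (fun x : ℝ => x⁻¹) σ = support σ := by
  have h := cfc_mul (R := ℝ) id (fun x : ℝ => x⁻¹) σ (continuousOn_spectrum σ _)
    (continuousOn_spectrum σ _)
  rw [cfc_id ℝ σ] at h
  exact h.symm

theorem isSelfAdjoint_support (σ : Matrix n n ℂ) : IsSelfAdjoint (support σ) :=
  cfc_predicate _ σ

theorem support_mul_support (σ : Matrix n n ℂ) : support σ * support σ = support σ := by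
  rw [support, ← cfc_mul (R := ℝ) _ _ σ (continuousOn_spectrum σ _) (continuousOn_spectrum σ _)]
  exact cfc_congr fun x _ => by
    by_cases hx : x = 0 <;> simp [hx]

/-- Because `log 0 = 0`, the shift by `log r` occurs only at nonzero eigenvalues, that is, on the
support. -/
theorem cfc_log_smul {σ : Matrix n n ℂ} (hσ : IsSelfAdjoint σ) {r : ℝ} (hr : r ≠ 0) :
    cfc Real.log (r • σ) = cfc Real.log σ + Real.log r • support σ := by
  rw [← cfc_comp_smul r Real.log σ ((Set.Finite.image _ Matrix.finite_real_spectrum).continuousOn _)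
      hσ, support, ← cfc_smul (S := ℝ) (R := ℝ) _ _ _ (continuousOn_spectrum σ _),
    ← cfc_add (R := ℝ) σ _ _ (continuousOn_spectrum σ _) (continuousOn_spectrum σ _)]
  refine cfc_congr fun x _ => ?_
  by_cases hx : x = 0
  · simp [hx]
  · simp [Real.log_mul hr hx, hx, add_comm]

theorem traceLog_reindex (e : n ≃ m) {ρ : Matrix n n ℂ} (hρ : IsSelfAdjoint ρ) :
    traceLog (Matrix.reindex e e ρ) = traceLog ρ := by
  let φ : Matrix n n ℂ →⋆ₐ[ℂ] Matrix m m ℂ :=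
    { (Matrix.reindexAlgEquiv ℂ ℂ e : Matrix n n ℂ →ₐ[ℂ] Matrix m m ℂ) with
      map_star' := fun X => rfl }
  have h : Matrix.reindex e e ρ = φ ρ := rfl
  have ht : ∀ X, (φ X).trace = X.trace := fun X => by
    change (Matrix.reindex e e X).trace = _
    simp [Matrix.trace, ← e.symm.sum_comp (fun i => X i i)]
  rw [traceLog, h, ← map_cfc_matrix φ _ hρ, ← map_mul, ht, traceLog]

theorem partialTrace_reindex_prodAssoc {c : Type} (ρ : Matrix (a × b × c) (a × b × c) ℂ) :
    partialTrace (Matrix.reindex (Equiv.prodAssoc a b c).symm (Equiv.prodAssoc a b c).symm ρ) =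
      partialTrace (partialTrace ρ) := by
  ext k k'
  simp only [partialTrace, Matrix.of_apply, Fintype.sum_prod_type, Matrix.reindex_apply,
    Matrix.submatrix_apply, Equiv.symm_symm, Equiv.prodAssoc_apply]
  exact Finset.sum_comm

/-- Reassociating the indices makes `a × b` the first factor, so the left side is `H(AB|C)`. -/
theorem condEntropy_reindex_prodAssoc {c : Type} [Fintype c] [DecidableEq c]
    {ρ : Matrix (a × b × c) (a × b × c) ℂ} (hρ : IsSelfAdjoint ρ) :
    condEntropy (Matrix.reindex (Equiv.prodAssoc a b c).symm (Equiv.prodAssoc a b c).symm ρ) =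
      traceLog ρ - traceLog (partialTrace (partialTrace ρ)) := by
  rw [condEntropy, traceLog_reindex _ hρ, partialTrace_reindex_prodAssoc]

end Matrix

/-! ### States on matrix algebras and their relative entropy -/

section States

variable {n m : Type} [Fintype n] [DecidableEq n] [Fintype m] [DecidableEq m]

/-- The state `tr (ρ ·)` of a density matrix `ρ`. -/
def State.ofDensity (ρ : Matrix n n ℂ) (hρ : ρ.PosSemidef) (h1 : ρ.trace = 1) :
    State (CStarMatrix n n ℂ) where
  functional := PositiveLinearMap.mk₀
    { toFun := fun M => (ρ * CStarMatrix.ofMatrix.symm M).trace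
      map_add' := fun M N => by
        rw [← Matrix.trace_add, ← mul_add]
        rfl
      map_smul' := fun c M => by
        rw [RingHom.id_apply, ← Matrix.trace_smul, ← mul_smul_comm]
        rfl }
    (by
      intro M hM
      obtain ⟨N, rfl⟩ := CStarAlgebra.exists_eq_star_mul_self hM
      exact trace_mul_star_mul_self_nonneg hρ (CStarMatrix.ofMatrix.symm N))
  map_one := by
    change (ρ * 1).trace = 1
    rw [mul_one, h1]

theorem State.faithful_ofDensity {ρ : Matrix n n ℂ} (hρ : ρ.PosDef) (h1 : ρ.trace = 1) :
    (State.ofDensity ρ hρ.posSemidef h1).Faithful := by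
  intro M hM
  have h : CStarMatrix.ofMatrix.symm M * ρ = 0 :=
    mul_eq_zero_of_trace_mul_star_mul_self_eq_zero hρ.posSemidef hM
  have h0 : CStarMatrix.ofMatrix.symm M = 0 := hρ.isUnit.mul_left_eq_zero.mp h
  exact h0

theorem State.density_matrixBlocks {ω : State (CStarMatrix n n ℂ)} {ρ : Matrix n n ℂ}
    (h : ∀ M, ω (CStarMatrix.ofMatrix M) = (ρ * M).trace) :
    ω.density (matrixBlocks n) () = ρ := by
  have key : ∀ i j : n, ω (CStarMatrix.ofMatrix (Matrix.single j i (1 : ℂ))) = ρ i j :=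
    fun i j => by rw [h, Matrix.trace_mul_single]; simp
  exact funext fun i => funext fun j => key i j

theorem relEntropy_matrixBlocks {ω ω' : State (CStarMatrix n n ℂ)} {ρ ρ' : Matrix n n ℂ}
    (hω : ∀ M, ω (CStarMatrix.ofMatrix M) = (ρ * M).trace)
    (hω' : ∀ M, ω' (CStarMatrix.ofMatrix M) = (ρ' * M).trace) (h : ω.AbsCont ω') :
    relEntropy (matrixBlocks n) ω ω' =
      (((ρ * (cfc Real.log ρ - cfc Real.log ρ')).trace.re : ℝ) : EReal) := by
  obtain rfl := State.density_matrixBlocks hω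
  obtain rfl := State.density_matrixBlocks hω'
  rw [relEntropy, if_pos h]
  exact congrArg (fun z : ℂ => ((z.re : ℝ) : EReal)) (Fintype.sum_unique (ι := Unit) _)

/-- The relative entropy of `tr (ρ ·)` with respect to `tr (r φ(σ) ·)`, for the restriction
`σ` of `ρ` along a unital ⋆-homomorphism `φ`. -/
theorem relEntropy_matrix {ω ω' : State (CStarMatrix n n ℂ)} {ρ : Matrix n n ℂ}
    {σ : Matrix m m ℂ} (φ : Matrix m m ℂ →⋆ₐ[ℂ] Matrix n n ℂ) (hρ : ρ.PosSemidef)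
    (hσ : σ.PosSemidef) (h1 : σ.trace = 1) (hφ : ∀ X, (ρ * φ X).trace = (σ * X).trace)
    {r : ℝ} (hr : 0 < r) (hω : ∀ M, ω (CStarMatrix.ofMatrix M) = (ρ * M).trace)
    (hω' : ∀ M, ω' (CStarMatrix.ofMatrix M) = ((r • φ σ) * M).trace) :
    relEntropy (matrixBlocks n) ω ω' =
      ((traceLog ρ - traceLog σ - Real.log r : ℝ) : EReal) := by
  have hsa : IsSelfAdjoint σ := hσ.isHermitian
  have hφσ : (φ σ).PosSemidef := by
    obtain ⟨X, rfl⟩ := exists_eq_conjTranspose_mul_self hσ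
    rw [map_mul, ← Matrix.star_eq_conjTranspose, map_star]
    exact Matrix.posSemidef_conjTranspose_mul_self _
  -- The projection `1 - support σ` has expectation `tr (σ (1 - support σ)) = 0` in `ρ`, so `ρ`
  -- lives under `φ (support σ)`.
  have hker : φ (1 - support σ) * ρ = 0 := by
    apply mul_eq_zero_of_trace_mul_star_mul_self_eq_zero hρ
    have hsq : star (1 - support σ) * (1 - support σ) = 1 - support σ := by
      rw [star_sub, star_one, (isSelfAdjoint_support σ).star_eq, mul_sub, mul_one, sub_mul,
        one_mul, support_mul_support, sub_self, sub_zero]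
    rw [← map_star, ← map_mul, hsq, hφ, mul_sub, mul_one, mul_support hsa, sub_self,
      Matrix.trace_zero]
  have hac : ω.AbsCont ω' := by
    intro M hM
    obtain ⟨M, rfl⟩ := CStarMatrix.ofMatrix.surjective M
    have e : star (CStarMatrix.ofMatrix M) * CStarMatrix.ofMatrix M =
      CStarMatrix.ofMatrix (star M * M) := rfl
    rw [e, hω', smul_mul_assoc, Matrix.trace_smul, smul_eq_zero] at hM
    have h0 := mul_eq_zero_of_trace_mul_star_mul_self_eq_zero hφσ (hM.resolve_left hr.ne')
    -- The support is `σ` times its pseudo-inverse, so annihilating `φ σ` annihilates `φ (support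
    -- σ)`.
    have h2 : M * φ (support σ) = 0 := by
      rw [← mul_cfc_inv hsa, map_mul, ← mul_assoc, h0, zero_mul]
    have h3 : M * ρ = 0 := by
      rw [map_sub, map_one, sub_mul, one_mul, sub_eq_zero] at hker
      rw [hker, ← mul_assoc, h2, zero_mul]
    rw [e, hω, Matrix.trace_mul_comm, mul_assoc, h3, mul_zero, Matrix.trace_zero]
  rw [relEntropy_matrixBlocks hω hω' hac, EReal.coe_eq_coe_iff]
  have hlog : (ρ * cfc Real.log (r • φ σ)).trace =
      (σ * cfc Real.log σ).trace + Real.log r := by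
    have e : r • φ σ = φ (r • σ) := by
      rw [← Complex.coe_smul, ← Complex.coe_smul, map_smul]
    rw [e, ← map_cfc_matrix φ _ ((IsSelfAdjoint.all r).smul hsa), hφ, cfc_log_smul hsa hr.ne',
      mul_add, mul_smul_comm, mul_support hsa, Matrix.trace_add, Matrix.trace_smul, h1]
    simp
  rw [mul_sub, Matrix.trace_sub, hlog, traceLog, traceLog]
  simp only [Complex.sub_re, Complex.add_re, Complex.ofReal_re]
  ring

end States

/-! ### The inclusion of a tensor factor and the normalized partial trace -/

section Tensor

variable (a b : Type) [Fintype a] [DecidableEq a] [Fintype b] [DecidableEq b]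

/-- The inclusion `X ↦ 1 ⊗ X` of `M_b` into `M_a ⊗ M_b`. -/
def tensorInclusion : CStarMatrix b b ℂ →⋆ₐ[ℂ] CStarMatrix (a × b) (a × b) ℂ where
  toFun X := CStarMatrix.ofMatrix (oneKronecker a b (CStarMatrix.ofMatrix.symm X))
  map_one' := map_one (oneKronecker a b)
  map_mul' X Y := map_mul (oneKronecker a b) X Y
  map_zero' := map_zero (oneKronecker a b)
  map_add' X Y := map_add (oneKronecker a b) X Y
  commutes' r := AlgHomClass.commutes (oneKronecker a b) r
  map_star' X := map_star (oneKronecker a b) X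

variable {a b}

/-- The block of a matrix on `a × b` with row `t` and column `s` in the first factor. -/
def tensorBlock (t s : a) (X : CStarMatrix (a × b) (a × b) ℂ) : CStarMatrix b b ℂ :=
  CStarMatrix.ofMatrix fun j j' => X (t, j) (s, j')

variable (a b)

/-- The normalized partial trace over the first factor. -/
def normalizedPartialTraceₗ : CStarMatrix (a × b) (a × b) ℂ →ₗ[ℂ] CStarMatrix b b ℂ where
  toFun M := (Fintype.card a : ℂ)⁻¹ •
    CStarMatrix.ofMatrix (partialTrace (CStarMatrix.ofMatrix.symm M))
  map_add' M N := by
    rw [← smul_add]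
    congr 1
    ext j j'
    exact Finset.sum_add_distrib
  map_smul' c M := by
    rw [RingHom.id_apply, smul_comm]
    congr 1
    ext j j'
    exact (Finset.mul_sum _ _ _).symm

variable {a b}

/-- A Kraus-type decomposition: for `X = Y` a sum of squares of blocks. Applied entrywise to `star N
* N`, it gives complete positivity. -/
theorem normalizedPartialTraceₗ_star_mul (X Y : CStarMatrix (a × b) (a × b) ℂ) :
    normalizedPartialTraceₗ a b (star X * Y) =
      (Fintype.card a : ℂ)⁻¹ • ∑ s, ∑ t, star (tensorBlock t s X) * tensorBlock t s Y := by
  refine congrArg (fun Z : CStarMatrix b b ℂ => (Fintype.card a : ℂ)⁻¹ • Z) ?_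
  ext j j'
  simp only [CStarMatrix.sum_apply, CStarMatrix.mul_apply, CStarMatrix.star_apply]
  change ∑ s, ∑ p : a × b, star (X p (s, j)) * Y p (s, j') = _
  simp only [Fintype.sum_prod_type]
  rfl

variable (a b)

/-- The normalized partial trace over the first factor, as a completely positive map. -/
def normalizedPartialTrace [Nonempty a] :
    CPU (CStarMatrix (a × b) (a × b) ℂ) (CStarMatrix b b ℂ) where
  toCP :=
    { toLinearMap := normalizedPartialTraceₗ a b
      map_cstarMatrix_nonneg' := fun k M hM => by
        obtain ⟨N, rfl⟩ := CStarAlgebra.exists_eq_star_mul_self hM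
        have h : (star N * N).map (normalizedPartialTraceₗ a b) = (Fintype.card a : ℂ)⁻¹ •
            ∑ s, ∑ t, star (N.map (tensorBlock t s)) * N.map (tensorBlock t s) := by
          refine CStarMatrix.ext fun i j => ?_
          rw [CStarMatrix.map_apply, CStarMatrix.mul_apply, map_sum, CStarMatrix.smul_apply]
          simp only [CStarMatrix.sum_apply, CStarMatrix.mul_apply, CStarMatrix.star_apply,
            CStarMatrix.map_apply, normalizedPartialTraceₗ_star_mul]
          rw [← Finset.smul_sum]
          congr 1
          rw [Finset.sum_comm]
          exact Finset.sum_congr rfl fun s _ => Finset.sum_comm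
        rw [h]
        refine smul_nonneg (by positivity) ?_
        exact Finset.sum_nonneg fun s _ => Finset.sum_nonneg fun t _ => star_mul_self_nonneg _ }
  map_one := by
    change (Fintype.card a : ℂ)⁻¹ • CStarMatrix.ofMatrix (partialTrace 1) = 1
    rw [← Matrix.one_kronecker_one, partialTrace_one_kronecker]
    exact inv_smul_smul₀ (by simp) _

variable {a b}

theorem faithful_normalizedPartialTrace [Nonempty a] : (normalizedPartialTrace a b).Faithful := by
  intro M hM
  have h : (Fintype.card a : ℂ)⁻¹ • partialTrace
    (star (CStarMatrix.ofMatrix.symm M) * CStarMatrix.ofMatrix.symm M) = 0 := hM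
  rw [smul_eq_zero] at h
  have h1 := congrArg Matrix.trace (h.resolve_left (by simp))
  rw [trace_partialTrace, Matrix.trace_zero] at h1
  exact Matrix.trace_conjTranspose_mul_self_eq_zero_iff.mp h1

/-- This identifies the density of the pulled-back state as `(1 / |a|) (1 ⊗ σ)`, the form needed in
`relEntropy_matrix`. -/
theorem trace_mul_normalizedPartialTrace (σ : Matrix b b ℂ) (M : Matrix (a × b) (a × b) ℂ) :
    (σ * ((Fintype.card a : ℂ)⁻¹ • partialTrace M)).trace =
      (((Fintype.card a : ℝ)⁻¹ • oneKronecker a b σ) * M).trace := by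
  rw [mul_smul_comm, Matrix.trace_smul, smul_mul_assoc, Matrix.trace_smul, Matrix.trace_mul_comm,
    ← trace_mul_one_kronecker, Matrix.trace_mul_comm, ← Complex.coe_smul]
  norm_num
  left
  rfl

/-- The morphism given by the inclusion of a tensor factor and the normalized partial trace. -/
def tensorHypothesis [Nonempty a] (ρ : Matrix (a × b) (a × b) ℂ) (hρ : ρ.PosSemidef)
    (h1 : ρ.trace = 1) :
    Hypothesis (State.ofDensity (partialTrace ρ) (partialTrace_posSemidef hρ)
      ((trace_partialTrace ρ).trans h1)) (State.ofDensity ρ hρ h1) where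
  F := tensorInclusion a b
  Q := normalizedPartialTrace a b
  state_comp X := trace_mul_one_kronecker ρ (CStarMatrix.ofMatrix.symm X)
  section_comp X := by
    change (Fintype.card a : ℂ)⁻¹ •
      CStarMatrix.ofMatrix (partialTrace ((1 : Matrix a a ℂ) ⊗ₖ CStarMatrix.ofMatrix.symm X)) = X
    rw [partialTrace_one_kronecker]
    exact inv_smul_smul₀ (by simp) X

theorem RE_tensorHypothesis [Nonempty a] (ρ : Matrix (a × b) (a × b) ℂ) (hρ : ρ.PosSemidef)
    (h1 : ρ.trace = 1) :
    RE (matrixBlocks (a × b)) (tensorHypothesis ρ hρ h1) =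
      ((condEntropy ρ + Real.log (Fintype.card a) : ℝ) : EReal) := by
  have h := relEntropy_matrix (ω := State.ofDensity ρ hρ h1)
    (ω' := (State.ofDensity (partialTrace ρ) (partialTrace_posSemidef hρ)
      ((trace_partialTrace ρ).trans h1)).pullback (normalizedPartialTrace a b))
    (oneKronecker a b) hρ (partialTrace_posSemidef hρ) ((trace_partialTrace ρ).trans h1)
    (trace_mul_one_kronecker ρ) (r := (Fintype.card a : ℝ)⁻¹)
    (by simpa using Fintype.card_pos) (fun _ => rfl)
    (fun M => trace_mul_normalizedPartialTrace (partialTrace ρ) M)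
  rw [RE]
  refine h.trans ?_
  rw [Real.log_inv, sub_neg_eq_add, condEntropy]

variable {c : Type} [Fintype c] [DecidableEq c]

theorem RE_comp_tensorHypothesis [Nonempty a] [Nonempty b]
    (ρ : Matrix (a × b × c) (a × b × c) ℂ) (hρ : ρ.PosSemidef) (h1 : ρ.trace = 1) :
    RE (matrixBlocks (a × b × c)) ((tensorHypothesis ρ hρ h1).comp
        (tensorHypothesis (partialTrace ρ) (partialTrace_posSemidef hρ)
          ((trace_partialTrace ρ).trans h1))) =
      ((condEntropy (Matrix.reindex (Equiv.prodAssoc a b c).symm (Equiv.prodAssoc a b c).symm ρ) +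
        Real.log (Fintype.card a) + Real.log (Fintype.card b) : ℝ) : EReal) := by
  have hσ := partialTrace_posSemidef (partialTrace_posSemidef hρ)
  have hσ1 := (trace_partialTrace (partialTrace ρ)).trans ((trace_partialTrace ρ).trans h1)
  have ha : (0 : ℝ) < Fintype.card a := by exact_mod_cast Fintype.card_pos
  have hb : (0 : ℝ) < Fintype.card b := by exact_mod_cast Fintype.card_pos
  have h := relEntropy_matrix (ω := State.ofDensity ρ hρ h1)
    (ω' := (State.ofDensity (partialTrace (partialTrace ρ)) hσ hσ1).pullback
      ((normalizedPartialTrace b c).comp (normalizedPartialTrace a (b × c))))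
    ((oneKronecker a (b × c)).comp (oneKronecker b c)) hρ hσ hσ1
    (fun X => (trace_mul_one_kronecker ρ _).trans (trace_mul_one_kronecker _ X))
    -- Each normalized partial trace contributes one factor to the scalar, and `- log r` splits
    -- accordingly.
    (r := (Fintype.card a : ℝ)⁻¹ * (Fintype.card b : ℝ)⁻¹)
    (by positivity) (fun _ => rfl)
    (fun M => by
      refine (trace_mul_normalizedPartialTrace (partialTrace (partialTrace ρ))
        ((Fintype.card a : ℂ)⁻¹ • partialTrace M)).trans ?_
      rw [trace_mul_normalizedPartialTrace, mul_smul]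
      congr 3
      rw [← Complex.coe_smul, ← Complex.coe_smul, map_smul]
      rfl)
  rw [RE]
  refine h.trans ?_
  rw [Real.log_mul (inv_pos.mpr ha).ne' (inv_pos.mpr hb).ne', Real.log_inv, Real.log_inv,
    condEntropy_reindex_prodAssoc hρ.isHermitian, EReal.coe_eq_coe_iff]
  ring

end Tensor

end

end NCStat

theorem mainTheorem1 :
    -- The chain rule and functoriality of the relative entropy.
    (∀ {A B C : Type*}
      [CStarAlgebra A] [PartialOrder A] [StarOrderedRing A] [FiniteDimensional ℂ A]
      [CStarAlgebra B] [PartialOrder B] [StarOrderedRing B] [FiniteDimensional ℂ B]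
      [CStarAlgebra C] [PartialOrder C] [StarOrderedRing C] [FiniteDimensional ℂ C]
      (dA : NCStat.Blocks A) (dB : NCStat.Blocks B)
      (ω : NCStat.State A) (ξ : NCStat.State B) (ζ : NCStat.State C)
      (f : NCStat.Hypothesis ξ ω) (g : NCStat.Hypothesis ζ ξ),
      ω.Faithful → ξ.Faithful → ζ.Faithful → f.Q.Faithful → g.Q.Faithful →
        NCStat.relEntropy dA ω (ζ.pullback (g.Q.comp f.Q)) =
            NCStat.relEntropy dB ξ (ζ.pullback g.Q) + NCStat.relEntropy dA ω (ξ.pullback f.Q) ∧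
        NCStat.RE dA (f.comp g) = NCStat.RE dB g + NCStat.RE dA f ∧
        NCStat.RE dA (f.comp g) ≠ ⊤ ∧ NCStat.RE dB g ≠ ⊤ ∧ NCStat.RE dA f ≠ ⊤) ∧
    -- The chain rule for the quantum conditional entropy as the special case of the inclusions
    -- of `M_c` into `M_b ⊗ M_c` and of `M_b ⊗ M_c` into `M_a ⊗ M_b ⊗ M_c`.
    (∀ (a b c : ℕ) (ρ : Matrix (Fin a × Fin b × Fin c) (Fin a × Fin b × Fin c) ℂ),
      ρ.PosSemidef → ρ.trace = 1 →
      ∃ (ω : NCStat.State (CStarMatrix (Fin a × Fin b × Fin c) (Fin a × Fin b × Fin c) ℂ))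
        (ξ : NCStat.State (CStarMatrix (Fin b × Fin c) (Fin b × Fin c) ℂ))
        (ζ : NCStat.State (CStarMatrix (Fin c) (Fin c) ℂ))
        (f : NCStat.Hypothesis ξ ω) (g : NCStat.Hypothesis ζ ξ),
        (∀ M, ω (CStarMatrix.ofMatrix M) = (ρ * M).trace) ∧
        (∀ M, ξ (CStarMatrix.ofMatrix M) = (NCStat.partialTrace ρ * M).trace) ∧
        (∀ M, ζ (CStarMatrix.ofMatrix M) =
          (NCStat.partialTrace (NCStat.partialTrace ρ) * M).trace) ∧
        (∀ M, f.F (CStarMatrix.ofMatrix M) =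
          CStarMatrix.ofMatrix ((1 : Matrix (Fin a) (Fin a) ℂ) ⊗ₖ M)) ∧
        (∀ M, g.F (CStarMatrix.ofMatrix M) =
          CStarMatrix.ofMatrix ((1 : Matrix (Fin b) (Fin b) ℂ) ⊗ₖ M)) ∧
        (∀ M, f.Q (CStarMatrix.ofMatrix M) = CStarMatrix.ofMatrix
          (NCStat.partialTrace
            ((NCStat.maxMixed (Fin a) ⊗ₖ (1 : Matrix (Fin b × Fin c) (Fin b × Fin c) ℂ)) * M))) ∧
        (∀ M, g.Q (CStarMatrix.ofMatrix M) = CStarMatrix.ofMatrix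
          (NCStat.partialTrace
            ((NCStat.maxMixed (Fin b) ⊗ₖ (1 : Matrix (Fin c) (Fin c) ℂ)) * M))) ∧
        f.Q.Faithful ∧ g.Q.Faithful ∧
        (ρ.PosDef → ω.Faithful ∧ ξ.Faithful ∧ ζ.Faithful) ∧
        NCStat.RE (NCStat.matrixBlocks (Fin a × Fin b × Fin c)) (f.comp g) =
          ((NCStat.condEntropy (Matrix.reindex (Equiv.prodAssoc (Fin a) (Fin b) (Fin c)).symm
              (Equiv.prodAssoc (Fin a) (Fin b) (Fin c)).symm ρ)
            + Real.log a + Real.log b : ℝ) : EReal) ∧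
        NCStat.RE (NCStat.matrixBlocks (Fin b × Fin c)) g =
          ((NCStat.condEntropy (NCStat.partialTrace ρ) + Real.log b : ℝ) : EReal) ∧
        NCStat.RE (NCStat.matrixBlocks (Fin a × Fin b × Fin c)) f =
          ((NCStat.condEntropy ρ + Real.log a : ℝ) : EReal) ∧
        NCStat.condEntropy (Matrix.reindex (Equiv.prodAssoc (Fin a) (Fin b) (Fin c)).symm
            (Equiv.prodAssoc (Fin a) (Fin b) (Fin c)).symm ρ) =
          NCStat.condEntropy ρ + NCStat.condEntropy (NCStat.partialTrace ρ)) := by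
  refine ⟨?_, ?_⟩
  · intro A B C _ _ _ _ _ _ _ _ _ _ _ _ dA dB ω ξ ζ f g hω hξ hζ hQ hR
    have h := NCStat.relEntropy_pullback_comp dA dB f g.Q hω hξ hζ hQ hR
    refine ⟨h, h, ?_, ?_, ?_⟩
    · exact (NCStat.relEntropy_of_faithful dA hω ((hζ.pullback hR).pullback hQ)).trans_ne
        (EReal.coe_ne_top _)
    · exact (NCStat.relEntropy_of_faithful dB hξ (hζ.pullback hR)).trans_ne
        (EReal.coe_ne_top _)
    · exact (NCStat.relEntropy_of_faithful dA hω (hξ.pullback hQ)).trans_ne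
        (EReal.coe_ne_top _)
  · intro a b c ρ hρ h1
    -- Trace one rules out zero dimensions, where the normalized partial traces would not be unital.
    have hne : Nonempty (Fin a × Fin b × Fin c) := by
      by_contra h
      rw [not_nonempty_iff] at h
      simp [Matrix.trace] at h1
    obtain ⟨i, j, k⟩ := hne
    have : Nonempty (Fin a) := ⟨i⟩
    have : Nonempty (Fin b) := ⟨j⟩
    have hBC := NCStat.partialTrace_posSemidef hρ
    have h1' := (NCStat.trace_partialTrace ρ).trans h1
    refine ⟨_, _, _, NCStat.tensorHypothesis ρ hρ h1, NCStat.tensorHypothesis _ hBC h1',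
      fun M => rfl, fun M => rfl, fun M => rfl, fun M => rfl, fun M => rfl, fun M => ?_,
      fun M => ?_, NCStat.faithful_normalizedPartialTrace, NCStat.faithful_normalizedPartialTrace,
      fun hpos => ⟨NCStat.State.faithful_ofDensity hpos h1,
        NCStat.State.faithful_ofDensity (NCStat.partialTrace_posDef hpos) h1',
        NCStat.State.faithful_ofDensity
          (NCStat.partialTrace_posDef (NCStat.partialTrace_posDef hpos)) _⟩, ?_, ?_, ?_, ?_⟩
    · rw [NCStat.partialTrace_maxMixed_mul]
      rfl
    · rw [NCStat.partialTrace_maxMixed_mul]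
      rfl
    · have h := NCStat.RE_comp_tensorHypothesis ρ hρ h1
      rwa [Fintype.card_fin, Fintype.card_fin] at h
    · have h := NCStat.RE_tensorHypothesis _ hBC h1'
      rwa [Fintype.card_fin] at h
    · have h := NCStat.RE_tensorHypothesis ρ hρ h1
      rwa [Fintype.card_fin] at h
    -- The term of `ρ_BC` telescopes.
    · rw [NCStat.condEntropy_reindex_prodAssoc hρ.isHermitian, NCStat.condEntropy,
        NCStat.condEntropy]
      ring
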